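/- **Theorem (VC-theorem for thickets).** Let $(X,\mu)$ be a finite probability space (every subset of $X$ is measurable) and let $\mathcal F\subseteq\mathcal P(X)$ be a family of subsets. For $n\ge 0$ let $2^{<n}$ be the set of binary sequences of length less than $n$, which has $2^n-1$ elements. A *tree of height $n$* is a family $\bar x=(x_\sigma)_{\sigma\in 2^{<n}}\in X^{2^n-1}$ of elements of $X$. A sequence $\tau\in\{0,1\}^n$ is *properly labeled* by $A\subseteq X$ in $\bar x$ if for all $m<n$ one has $x_{\tau|_{[m]}}\in A$ if and only if $\tau(m)=1$, where $\tau|_{[m]}=(\tau(0),\dots,\tau(m-1))$. Let the thicket shatter function $\rho_{\mathcal F}(n)$ be the maximum, over all trees $\bar x$ of height $n$, of the number of $\tau\in\{0,1\}^n$ that are properly labeled in $\bar x$ by some element of $\mathcal F$. For a tree $\bar x$ of height $n$ and $S\subseteq X$ put $$\mathrm{test}(\bar x,S)=\frac1n\sum_{i=0}^{n-1}\ \sum_{\tau\in\{0,1\}^i}\Bigl(1_S(x_\tau)\prod_{j=0}^{i-1}\chi_S^{\tau}(x_{\tau|_{[j]}})\Bigr),$$ where $1_S$ is the indicator function of $S$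 and $\chi_S^{\tau}(x_{\tau|_{[j]}})$ is $1$ if ($x_{\tau|_{[j]}}\in S\Leftrightarrow\tau(j)=1$) and $0$ otherwise (for $n=0$, $\mathrm{test}(\bar x,S)=0$). Then for every $n\ge 0$ and every $\epsilon>0$, $$\mu^{2^n-1}\Bigl(\Bigl\{\bar x\in X^{2^n-1}:\ \sup_{S\in\mathcal F}\bigl|\mathrm{test}(\bar x,S)-\mu(S)\bigr|>\epsilon\Bigr\}\Bigr)\ \le\ 8\,\rho_{\mathcal F}(n)\,\exp\Bigl(-\frac{n\epsilon^2}{32}\Bigr),$$ where the supremum over the empty family is $0$. -/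

import Mathlib

open MeasureTheory

noncomputable section

namespace Thicket

/-- The set `2^{<n}` of binary sequences of length less than `n`: a length `i < n` together with
a sequence of that length. It has `2 ^ n - 1` elements. -/
abbrev Node (n : ℕ) : Type := Σ i : Fin n, (Fin i → Bool)

/-- Binary element trees (test trees) of height `n` with labels from `X`. -/
abbrev ElementTree (n : ℕ) (X : Type*) : Type _ := Node n → X

/-- The initial segment `τ|_{[m]}` of a binary sequence `τ` of length `k ≤ n`, for `m < k`,
as a node of `2^{<n}`. -/
def initSeg {n k : ℕ} (hk : k ≤ n) (τ : Fin k → Bool) (m : Fin k) : Node n :=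
  ⟨⟨m, m.isLt.trans_le hk⟩, fun j => τ ⟨j, j.isLt.trans m.isLt⟩⟩

/-- The leaf `τ` of the tree `T` is properly labeled by the set `A`. -/
def ProperlyLabeled {n : ℕ} {X : Type*} (T : ElementTree n X) (τ : Fin n → Bool) (A : Set X) :
    Prop :=
  ∀ m : Fin n, T (initSeg le_rfl τ m) ∈ A ↔ τ m = true

/-- The leaves of `T` that are properly labeled by some element of `F`. -/
def properLeaves {n : ℕ} {X : Type*} (F : Set (Set X)) (T : ElementTree n X) :
    Set (Fin n → Bool) :=
  {τ | ∃ A ∈ F, ProperlyLabeled T τ A}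

/-- The thicket shatter function `ρ_F(n)`: the maximum, over all binary element trees of height `n`,
of the number of leaves properly labeled by elements of `F` (these numbers are at most `2 ^ n`). -/
def thicketShatter {X : Type*} (F : Set (Set X)) (n : ℕ) : ℕ :=
  ⨆ T : ElementTree n X, (properLeaves F T).ncard

open Classical in
/-- The indicator of the condition `y ∈ S ↔ b = 1`; it gives `χ_S^τ(x_σ)` for `y = x_σ` and
`b = τ(|σ|)`. -/
def chi {X : Type*} (S : Set X) (b : Bool) (y : X) : ℝ :=
  if (y ∈ S ↔ b = true) then 1 else 0

/-- `Y_{S,i}(x) = ∑_{τ ∈ 2^i} 1_S(x_τ) ∏_{σ < τ} χ_S^τ(x_σ)`; the proper initial segments `σ` of `τ`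
are indexed by their lengths `j < i`. -/
def query {n : ℕ} {X : Type*} (x : ElementTree n X) (S : Set X) (i : Fin n) : ℝ :=
  ∑ τ : Fin i → Bool,
    S.indicator 1 (x ⟨i, τ⟩) * ∏ j : Fin i, chi S (τ j) (x (initSeg i.isLt.le τ j))

/-- The thicket estimate `test(x, S)` of the measure of `S` (it is `0` for `n = 0`). -/
def test {n : ℕ} {X : Type*} (x : ElementTree n X) (S : Set X) : ℝ :=
  (1 / (n : ℝ)) * ∑ i : Fin n, query x S i

end Thicket

end

/-!
A set `S` picks out one path through a tree, turning to the subtree `1` at a node exactly when it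
contains the label there, and `test x S` is the frequency of membership along that path. In a random
tree the labels met along the path of `S` are independent with law `μ`, so the only difficulty is
uniformity in `S ∈ F`.

Symmetrization is carried out one level at a time. Jensen's inequality replaces one of the `n`
copies of `μ S` by the indicator of `S` at an independent point `y`. Once the answers `a` at the
root `x` and `b` at `y` are fixed, the supremum runs over the restriction of `F` to these answers
and the factor `exp (l * (a - b))` comes out. Exchanging `x` and `y` averages this factor to
`cosh l` when `a ≠ b`. Each level queries two points, and the shatter functions of the four
restrictions at height `2 * n` add up to at most that of `F` at height `2 * n + 2`, so by induction
the exponential moment of the largest deviation is at most `cosh l ^ n` times the shatter function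
at `2 * n`, which is at most the square of its value at `n`.

Markov's inequality with `l = ε` and `l = -ε` bounds the two tails. If `r` is the value of the
shatter function at `n` and `t = r * exp (-n * ε ^ 2 / 32)`, the bound is at most `2 * t ^ 2`; this
is at most `8 * t` unless `8 * t ≥ 1`, where there is nothing to prove.
-/

noncomputable section

open scoped ENNReal

namespace Thicket

variable {X : Type*} {n : ℕ}

/-! ### Roots and subtrees -/

/-- The empty sequence, as a node of `2^{<n+1}`. -/
def rootNode : Node (n + 1) := ⟨0, Fin.elim0⟩

/-- The node `b⌢σ` of `2^{<n+1}`. -/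
def consNode (b : Bool) (σ : Node n) : Node (n + 1) :=
  ⟨σ.1.succ, Fin.cons (α := fun _ => Bool) b σ.2⟩

/-- The label of the root of a tree of positive height. -/
def root (T : ElementTree (n + 1) X) : X := T rootNode

/-- The subtree of `T` of height `n` above the node `(b)`. -/
def subtree (T : ElementTree (n + 1) X) (b : Bool) : ElementTree n X := fun σ => T (consNode b σ)

/-- The tree with root label `x` whose subtree above the node `(b)` is `T b`. -/
def join (x : X) (T : Bool → ElementTree n X) : ElementTree (n + 1) X
  | ⟨⟨0, _⟩, _⟩ => x
  | ⟨⟨i + 1, hi⟩, τ⟩ => T (τ 0) ⟨⟨i, Nat.lt_of_succ_lt_succ hi⟩, Fin.tail τ⟩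

@[simp]
theorem root_join (x : X) (T : Bool → ElementTree n X) : root (join x T) = x := rfl

@[simp]
theorem subtree_join (x : X) (T : Bool → ElementTree n X) (b : Bool) :
    subtree (join x T) b = T b := rfl

theorem initSeg_cons_zero {k : ℕ} (hk : k + 1 ≤ n + 1) (b : Bool) (τ : Fin k → Bool) :
    initSeg hk (Fin.cons (α := fun _ => Bool) b τ) 0 = rootNode :=
  congrArg (Sigma.mk (0 : Fin (n + 1))) (funext fun j => j.elim0)

theorem initSeg_cons_succ {k : ℕ} (hk : k ≤ n) (b : Bool) (τ : Fin k → Bool) (m : Fin k) :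
    initSeg (Nat.succ_le_succ hk) (Fin.cons (α := fun _ => Bool) b τ) m.succ =
      consNode b (initSeg hk τ m) :=
  congrArg (Sigma.mk _) (funext fun j => Fin.cases rfl (fun _ => rfl) j)

/-! ### The thicket shatter function -/

/-- The members of `F` that contain `x` if `b = true`, and those that omit `x` otherwise. -/
def restrict (F : Set (Set X)) (x : X) (b : Bool) : Set (Set X) :=
  {S | S ∈ F ∧ (x ∈ S ↔ b = true)}

theorem restrict_subset (F : Set (Set X)) (x : X) (b : Bool) : restrict F x b ⊆ F :=
  fun _ hS => hS.1

open Classical in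
theorem mem_restrict_decide {F : Set (Set X)} {S : Set X} (hS : S ∈ F) (x : X) :
    S ∈ restrict F x (decide (x ∈ S)) :=
  ⟨hS, by simp⟩

theorem restrict_comm (F : Set (Set X)) (x y : X) (a b : Bool) :
    restrict (restrict F x a) y b = restrict (restrict F y b) x a :=
  Set.ext fun _ => and_right_comm

theorem properlyLabeled_cons (T : ElementTree (n + 1) X) (b : Bool) (τ : Fin n → Bool)
    (A : Set X) :
    ProperlyLabeled T (Fin.cons (α := fun _ => Bool) b τ) A ↔
      (root T ∈ A ↔ b = true) ∧ ProperlyLabeled (subtree T b) τ A := by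
  have hzero := initSeg_cons_zero (Nat.le_refl (n + 1)) b τ
  have hsucc := initSeg_cons_succ le_rfl b τ
  simp only [ProperlyLabeled, Fin.forall_fin_succ, hzero, hsucc, Fin.cons_zero, Fin.cons_succ]
  rfl

theorem cons_mem_properLeaves (F : Set (Set X)) (T : ElementTree (n + 1) X) (b : Bool)
    (τ : Fin n → Bool) :
    Fin.cons (α := fun _ => Bool) b τ ∈ properLeaves F T ↔
      τ ∈ properLeaves (restrict F (root T) b) (subtree T b) := by
  simp only [properLeaves, restrict, Set.mem_ofPred_eq, properlyLabeled_cons, and_assoc]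

theorem ncard_properLeaves_succ (F : Set (Set X)) (T : ElementTree (n + 1) X) :
    (properLeaves F T).ncard =
      ∑ b, (properLeaves (restrict F (root T) b) (subtree T b)).ncard := by
  let e : (Σ b, properLeaves (restrict F (root T) b) (subtree T b)) ≃ properLeaves F T :=
    (Equiv.subtypeProdEquivSigmaSubtype _).symm.trans
      ((Fin.consEquiv fun _ => Bool).subtypeEquiv fun p =>
        (cons_mem_properLeaves F T p.1 p.2).symm)
  simp only [← Nat.card_coe_set_eq, ← Nat.card_congr e, Nat.card_sigma]

theorem bddAbove_ncard_properLeaves (F : Set (Set X)) (n : ℕ) :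
    BddAbove (Set.range fun T : ElementTree n X => (properLeaves F T).ncard) :=
  ⟨Nat.card (Fin n → Bool), Set.forall_mem_range.2 fun _ => Set.ncard_le_card _⟩

theorem ncard_properLeaves_le (F : Set (Set X)) (T : ElementTree n X) :
    (properLeaves F T).ncard ≤ thicketShatter F n :=
  le_ciSup (bddAbove_ncard_properLeaves F n) T

theorem exists_ncard_properLeaves_eq [Nonempty X] (F : Set (Set X)) (n : ℕ) :
    ∃ T : ElementTree n X, (properLeaves F T).ncard = thicketShatter F n :=
  Nat.sSup_mem (Set.range_nonempty _) (bddAbove_ncard_properLeaves F n)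

theorem properLeaves_mono {F G : Set (Set X)} (h : F ⊆ G) (T : ElementTree n X) :
    properLeaves F T ⊆ properLeaves G T :=
  fun _ ⟨A, hA, hτ⟩ => ⟨A, h hA, hτ⟩

theorem thicketShatter_mono {F G : Set (Set X)} (h : F ⊆ G) (n : ℕ) :
    thicketShatter F n ≤ thicketShatter G n :=
  ciSup_mono (bddAbove_ncard_properLeaves G n) fun T =>
    Set.ncard_le_ncard (properLeaves_mono h T)

theorem thicketShatter_zero {F : Set (Set X)} (hF : F.Nonempty) : thicketShatter F 0 = 1 := by
  obtain ⟨A, hA⟩ := hF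
  have huniv (T : ElementTree 0 X) : properLeaves F T = Set.univ :=
    Set.eq_univ_of_forall fun _ => ⟨A, hA, fun m => m.elim0⟩
  simp [thicketShatter, huniv, Set.ncard_univ]

theorem sum_thicketShatter_restrict_le (F : Set (Set X)) (x : X) (n : ℕ) :
    ∑ b, thicketShatter (restrict F x b) n ≤ thicketShatter F (n + 1) := by
  have : Nonempty X := ⟨x⟩
  choose T hT using fun b => exists_ncard_properLeaves_eq (restrict F x b) n
  simpa only [ncard_properLeaves_succ, root_join, subtree_join, hT] using
    ncard_properLeaves_le F (join x T)

theorem exists_thicketShatter_succ_le [Nonempty X] (F : Set (Set X)) (n : ℕ) :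
    ∃ x, thicketShatter F (n + 1) ≤ ∑ b, thicketShatter (restrict F x b) n := by
  obtain ⟨T, hT⟩ := exists_ncard_properLeaves_eq F (n + 1)
  refine ⟨root T, ?_⟩
  rw [← hT, ncard_properLeaves_succ]
  exact Finset.sum_le_sum fun b _ => ncard_properLeaves_le _ _

theorem thicketShatter_add_le [Nonempty X] (F : Set (Set X)) (m n : ℕ) :
    thicketShatter F (m + n) ≤ thicketShatter F m * thicketShatter F n := by
  induction m generalizing F with
  | zero =>
    rcases F.eq_empty_or_nonempty with rfl | hF
    · simp [thicketShatter, properLeaves]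
    · rw [zero_add, thicketShatter_zero hF, one_mul]
  | succ m ih =>
    obtain ⟨x, hx⟩ := exists_thicketShatter_succ_le F (m + n)
    calc thicketShatter F (m + 1 + n)
        ≤ ∑ b, thicketShatter (restrict F x b) (m + n) := by rwa [Nat.add_right_comm]
      _ ≤ ∑ b, thicketShatter (restrict F x b) m * thicketShatter F n :=
          Finset.sum_le_sum fun b _ => (ih _).trans
            (Nat.mul_le_mul_left _ (thicketShatter_mono (restrict_subset F x b) n))
      _ = (∑ b, thicketShatter (restrict F x b) m) * thicketShatter F n :=
          (Finset.sum_mul ..).symm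
      _ ≤ thicketShatter F (m + 1) * thicketShatter F n :=
          Nat.mul_le_mul_right _ (sum_thicketShatter_restrict_le F x m)

/-! ### Positive answers along the path of a set -/

/-- The number of nodes with label in `S` on the path that `S` takes through `T`, that is
`n * test T S`; it is a real number because `query` is. -/
def hits (T : ElementTree n X) (S : Set X) : ℝ := ∑ i, query T S i

theorem mul_test (T : ElementTree n X) (S : Set X) : n * test T S = hits T S := by
  rcases n.eq_zero_or_pos with rfl | hn
  · simp [hits]
  · rw [test, one_div, mul_inv_cancel_left₀ (Nat.cast_ne_zero.2 hn.ne'), hits]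

theorem indicator_one_eq_toNat (S : Set X) (x : X) [Decidable (x ∈ S)] :
    S.indicator (1 : X → ℝ) x = (decide (x ∈ S)).toNat := by
  by_cases h : x ∈ S <;> simp [h]

theorem query_zero (T : ElementTree (n + 1) X) (S : Set X) :
    query T S 0 = S.indicator 1 (root T) :=
  (Fintype.sum_unique (ι := Fin 0 → Bool) _).trans (mul_one _)

open Classical in
theorem query_succ (T : ElementTree (n + 1) X) (S : Set X) (i : Fin n) :
    query T S i.succ = query (subtree T (decide (root T ∈ S))) S i := by
  have hcons (b : Bool) (τ : Fin i → Bool) :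
      S.indicator (1 : X → ℝ) (T ⟨i.succ, Fin.cons (α := fun _ => Bool) b τ⟩) *
        ∏ j : Fin (i + 1), chi S (Fin.cons (α := fun _ => Bool) b τ j)
          (T (initSeg (k := i + 1) i.succ.isLt.le (Fin.cons (α := fun _ => Bool) b τ) j))
      = chi S b (root T) * (S.indicator 1 (subtree T b ⟨i, τ⟩) *
        ∏ j : Fin i, chi S (τ j) (subtree T b (initSeg i.isLt.le τ j))) := by
    rw [Fin.prod_univ_succ, initSeg_cons_zero, mul_left_comm]
    simp only [initSeg_cons_succ i.isLt.le b τ, Fin.cons_zero, Fin.cons_succ]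
    rfl
  calc query T S i.succ
      = ∑ b, ∑ τ : Fin i → Bool, chi S b (root T) * (S.indicator 1 (subtree T b ⟨i, τ⟩) *
          ∏ j : Fin i, chi S (τ j) (subtree T b (initSeg i.isLt.le τ j))) := by
        simp only [← hcons]
        rw [← Fintype.sum_prod_type']
        exact ((Fin.consEquiv fun _ : Fin (i + 1) => Bool).sum_comp _).symm
    _ = ∑ b, chi S b (root T) * query (subtree T b) S i := by
        simp only [← Finset.mul_sum, query]
    _ = query (subtree T (decide (root T ∈ S))) S i := by
        by_cases h : root T ∈ S <;> simp [chi, h]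

open Classical in
theorem hits_succ (T : ElementTree (n + 1) X) (S : Set X) :
    hits T S = (decide (root T ∈ S)).toNat + hits (subtree T (decide (root T ∈ S))) S := by
  simp only [hits, Fin.sum_univ_succ, query_zero, query_succ, indicator_one_eq_toNat]

/-! ### Random trees -/

theorem measurePreserving_pi_comp_injective {ι κ Ω : Type*} [Fintype ι] [Fintype κ]
    [MeasurableSpace Ω] (μ : Measure Ω) [IsProbabilityMeasure μ] {f : ι → κ}
    (hf : Function.Injective f) :
    MeasurePreserving (fun (ω : κ → Ω) i => ω (f i)) (Measure.pi fun _ => μ)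
      (Measure.pi fun _ => μ) where
  measurable := by fun_prop
  map_eq := by
    simpa only [Measure.infinitePi_eq_pi] using
      Measure.map_infinitePi_infinitePi_of_inj (P := fun _ : κ => μ) hf

theorem measurePreserving_pi_option {ι Ω : Type*} [Fintype ι] [MeasurableSpace Ω]
    (μ : Measure Ω) [SigmaFinite μ] :
    MeasurePreserving (fun ω : Option ι → Ω => (fun i => ω (some i), ω none))
      (Measure.pi fun _ => μ) ((Measure.pi fun _ => μ).prod μ) :=
  MeasurePreserving.symm (MeasurableEquiv.piOptionEquivProd fun _ : Option ι => Ω).symm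
    ⟨MeasurableEquiv.measurable _, Measure.pi_map_piOptionEquivProd fun _ => μ⟩

theorem consNode_injective (b : Bool) : Function.Injective (consNode (n := n) b) := by
  rintro ⟨i, σ⟩ ⟨j, τ⟩ h
  obtain ⟨hij, hστ⟩ := Sigma.mk.inj h
  obtain rfl := Fin.succ_injective _ hij
  exact congrArg (Sigma.mk i) (Fin.cons_right_injective (α := fun _ => Bool) b (eq_of_heq hστ))

theorem elim_rootNode_consNode_injective (b : Bool) :
    Function.Injective fun o : Option (Node n) => o.elim rootNode (consNode b) := by
  have hne (σ : Node n) : rootNode ≠ consNode b σ := fun h =>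
    (Fin.succ_ne_zero σ.1) (congrArg Sigma.fst h).symm
  rintro (_ | σ) (_ | τ) h
  · rfl
  · exact absurd h (hne τ)
  · exact absurd h.symm (hne σ)
  · exact congrArg some (consNode_injective b h)

variable [MeasurableSpace X]

/-- The law of a tree of height `n` whose labels are independent with law `μ`. -/
abbrev treeMeasure (μ : Measure X) (n : ℕ) : Measure (ElementTree n X) := Measure.pi fun _ => μ

theorem measurePreserving_subtree_root (μ : Measure X) [IsProbabilityMeasure μ] (b : Bool) :
    MeasurePreserving (fun T : ElementTree (n + 1) X => (subtree T b, root T))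
      (treeMeasure μ (n + 1)) ((treeMeasure μ n).prod μ) :=
  (measurePreserving_pi_option μ).comp
    (measurePreserving_pi_comp_injective μ (elim_rootNode_consNode_injective b))

theorem measurable_root_subtree (b : Bool) :
    Measurable fun p : ElementTree (n + 1) X × X => ((root p.1, p.2), subtree p.1 b) := by
  unfold root subtree
  fun_prop

theorem lintegral_lintegral_root_subtree (μ : Measure X) [IsProbabilityMeasure μ] (b : Bool)
    {g : X × X → ElementTree n X → ℝ≥0∞} (hg : Measurable (Function.uncurry g)) :
    ∫⁻ T, ∫⁻ y, g (root T, y) (subtree T b) ∂μ ∂treeMeasure μ (n + 1) =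
      ∫⁻ z, ∫⁻ T, g z T ∂treeMeasure μ n ∂μ.prod μ := by
  have hroot : Measurable fun p : (ElementTree n X × X) × X => g (p.1.2, p.2) p.1.1 :=
    hg.comp (by fun_prop : Measurable fun p : (ElementTree n X × X) × X => ((p.1.2, p.2), p.1.1))
  calc ∫⁻ T, ∫⁻ y, g (root T, y) (subtree T b) ∂μ ∂treeMeasure μ (n + 1)
      = ∫⁻ p, ∫⁻ y, g (p.2, y) p.1 ∂μ ∂(treeMeasure μ n).prod μ :=
        (measurePreserving_subtree_root μ b).lintegral_comp hroot.lintegral_prod_right'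
    _ = ∫⁻ x, ∫⁻ T, ∫⁻ y, g (x, y) T ∂μ ∂treeMeasure μ n ∂μ :=
        lintegral_prod_symm' _ hroot.lintegral_prod_right'
    _ = ∫⁻ x, ∫⁻ y, ∫⁻ T, g (x, y) T ∂treeMeasure μ n ∂μ ∂μ :=
        lintegral_congr fun x => lintegral_lintegral_swap <| Measurable.aemeasurable <|
          hroot.comp (by fun_prop : Measurable fun p : ElementTree n X × X => ((p.1, x), p.2))
    _ = ∫⁻ z, ∫⁻ T, g z T ∂treeMeasure μ n ∂μ.prod μ :=
        (lintegral_prod _ hg.lintegral_prod_right'.aemeasurable).symm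

theorem lintegral_sum_sum_const_mul {α ι κ : Type*} [Fintype ι] [Fintype κ] [MeasurableSpace α]
    (ν : Measure α) (w : ι → κ → ℝ≥0∞) {q : ι → κ → α → ℝ≥0∞} (hq : ∀ i j, Measurable (q i j)) :
    ∫⁻ z, ∑ i, ∑ j, w i j * q i j z ∂ν = ∑ i, ∑ j, w i j * ∫⁻ z, q i j z ∂ν := by
  rw [lintegral_finsetSum _ (by fun_prop)]
  refine Finset.sum_congr rfl fun i _ => ?_
  rw [lintegral_finsetSum _ (by fun_prop)]
  exact Finset.sum_congr rfl fun j _ => lintegral_const_mul _ (hq i j)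

theorem lintegral_lintegral_sum_root_subtree (μ : Measure X) [IsProbabilityMeasure μ]
    (w : Bool → Bool → ℝ≥0∞) {g : Bool → Bool → X × X → ElementTree n X → ℝ≥0∞}
    (hg : ∀ a b, Measurable (Function.uncurry (g a b))) :
    ∫⁻ T, ∫⁻ y, ∑ a, ∑ b, w a b * g a b (root T, y) (subtree T a) ∂μ ∂treeMeasure μ (n + 1) =
      ∑ a, ∑ b, w a b * ∫⁻ z, ∫⁻ T, g a b z T ∂treeMeasure μ n ∂μ.prod μ := by
  have hjoint (a b : Bool) : Measurable fun p : ElementTree (n + 1) X × X =>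
      g a b (root p.1, p.2) (subtree p.1 a) :=
    (hg a b).comp (measurable_root_subtree a)
  calc ∫⁻ T, ∫⁻ y, ∑ a, ∑ b, w a b * g a b (root T, y) (subtree T a) ∂μ ∂treeMeasure μ (n + 1)
      = ∫⁻ T, ∑ a, ∑ b, w a b * ∫⁻ y, g a b (root T, y) (subtree T a) ∂μ
          ∂treeMeasure μ (n + 1) :=
        lintegral_congr fun T => lintegral_sum_sum_const_mul μ w fun a b =>
          (hjoint a b).comp measurable_prodMk_left
    _ = ∑ a, ∑ b, w a b *
          ∫⁻ T, ∫⁻ y, g a b (root T, y) (subtree T a) ∂μ ∂treeMeasure μ (n + 1) :=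
        lintegral_sum_sum_const_mul _ w fun a b => (hjoint a b).lintegral_prod_right'
    _ = ∑ a, ∑ b, w a b * ∫⁻ z, ∫⁻ T, g a b z T ∂treeMeasure μ n ∂μ.prod μ :=
        Finset.sum_congr rfl fun a _ => Finset.sum_congr rfl fun b _ =>
          congrArg _ (lintegral_lintegral_root_subtree μ a (hg a b))

theorem measurable_chi {S : Set X} (hS : MeasurableSet S) (b : Bool) : Measurable (chi S b) :=
  Measurable.ite (hS.mem.iff measurable_const).setOf measurable_const measurable_const

theorem measurable_hits {S : Set X} (hS : MeasurableSet S) :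
    Measurable fun T : ElementTree n X => hits T S := by
  have hchi := measurable_chi hS
  have : Measurable (S.indicator (1 : X → ℝ)) := measurable_one.indicator hS
  unfold hits query
  fun_prop

/-! ### The exponential moment of the largest deviation -/

/-- The supremum over `S ∈ F` of `exp (n * l * (test T S - μ S))`; it is `0` if `F` is empty. -/
def supExpDeviation (μ : Measure X) (l : ℝ) (F : Set (Set X)) (T : ElementTree n X) : ℝ≥0∞ :=
  ⨆ S ∈ F, ENNReal.ofReal (Real.exp (l * (hits T S - n * μ.real S)))

theorem measurable_biSup_mem {α ι : Type*} [MeasurableSpace α] {I : Set ι} (hI : I.Countable)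
    {s : α → Set ι} (hsI : ∀ a, s a ⊆ I) (hs : ∀ i ∈ I, MeasurableSet {a | i ∈ s a})
    {f : ι → α → ℝ≥0∞} (hf : ∀ i ∈ I, Measurable (f i)) :
    Measurable fun a => ⨆ i ∈ s a, f i a := by
  classical
  have heq (a : α) : ⨆ i ∈ s a, f i a = ⨆ i ∈ I, {a | i ∈ s a}.indicator (f i) a := by
    refine le_antisymm (iSup₂_le fun i hi => ?_) (iSup₂_le fun i _ => ?_)
    · exact le_iSup₂_of_le i (hsI a hi) (by simp [hi])
    · by_cases hi : i ∈ s a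
      · simpa [hi] using le_biSup (f · a) hi
      · simp [hi]
  simp only [heq]
  exact Measurable.biSup I hI fun i hi => (hf i hi).indicator (hs i hi)

theorem measurableSet_mem_restrict {α : Type*} [MeasurableSpace α] {G : α → Set (Set X)}
    {S : Set X} (hG : MeasurableSet {z | S ∈ G z}) (hS : MeasurableSet S) {f : α → X}
    (hf : Measurable f) (b : Bool) : MeasurableSet {z | S ∈ restrict (G z) (f z) b} :=
  hG.inter ((hf hS).mem.iff measurable_const).setOf

theorem measurable_supExpDeviation_restrict (μ : Measure X) (l : ℝ) {F : Set (Set X)}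
    (hF : F.Countable) (hmeas : ∀ S ∈ F, MeasurableSet S) (a b : Bool) :
    Measurable fun p : (X × X) × ElementTree n X =>
      supExpDeviation μ l (restrict (restrict F p.1.1 a) p.1.2 b) p.2 := by
  refine measurable_biSup_mem hF
    (fun p => (restrict_subset _ _ _).trans (restrict_subset _ _ _)) (fun S hS => ?_)
    fun S hS => ?_
  · have hconst : MeasurableSet {_p : (X × X) × ElementTree n X | S ∈ F} := .const _
    exact measurableSet_mem_restrict
      (measurableSet_mem_restrict hconst (hmeas S hS) measurable_fst.fst a)
      (hmeas S hS) measurable_fst.snd b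
  · have := measurable_hits (n := n) (hmeas S hS)
    fun_prop

theorem ofReal_exp_mul_measureReal_le (μ : Measure X) [IsProbabilityMeasure μ] (l : ℝ)
    {S : Set X} (hS : MeasurableSet S) :
    ENNReal.ofReal (Real.exp (l * μ.real S)) ≤
      ∫⁻ y, ENNReal.ofReal (Real.exp (l * S.indicator 1 y)) ∂μ := by
  have hlin : Integrable (fun y => l * S.indicator (1 : X → ℝ) y) μ :=
    ((integrable_const 1).indicator hS).const_mul l
  have hexp : Integrable (fun y => Real.exp (l * S.indicator (1 : X → ℝ) y)) μ := by
    refine .of_bound (by fun_prop) (Real.exp |l|) (.of_forall fun y => ?_)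
    rw [Real.norm_of_nonneg (Real.exp_pos _).le, Real.exp_le_exp]
    by_cases hy : y ∈ S <;> simp [hy, le_abs_self]
  rw [← ofReal_integral_eq_lintegral_ofReal hexp (.of_forall fun _ => (Real.exp_pos _).le)]
  refine ENNReal.ofReal_le_ofReal ?_
  have := convexOn_exp.map_integral_le Real.continuousOn_exp isClosed_univ
    (.of_forall fun _ => Set.mem_univ _) hlin hexp
  rwa [integral_const_mul, integral_indicator_one hS] at this

theorem le_supExpDeviation (μ : Measure X) (l : ℝ) {F : Set (Set X)} {S : Set X} (hS : S ∈ F)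
    (T : ElementTree n X) :
    ENNReal.ofReal (Real.exp (l * (hits T S - n * μ.real S))) ≤ supExpDeviation μ l F T :=
  le_iSup₂ (f := fun S (_ : S ∈ F) => ENNReal.ofReal (Real.exp (l * (hits T S - n * μ.real S))))
    S hS

theorem measurable_supExpDeviation (μ : Measure X) (l : ℝ) {F : Set (Set X)}
    (hF : F.Countable) (hmeas : ∀ S ∈ F, MeasurableSet S) :
    Measurable (supExpDeviation (n := n) μ l F) :=
  Measurable.biSup F hF fun S hS => by
    have := measurable_hits (n := n) (hmeas S hS)
    fun_prop

/-- The factor `exp (l * (a - b))` by which the answers `a` and `b` of a set to two independent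
points change its exponential deviation. -/
def expDiff (l : ℝ) (a b : Bool) : ℝ≥0∞ :=
  ENNReal.ofReal (Real.exp (l * ((a.toNat : ℝ) - b.toNat)))

theorem expDiff_true_false_add (l : ℝ) :
    expDiff l true false + expDiff l false true = 2 * ENNReal.ofReal (Real.cosh l) := by
  have hcosh : Real.exp l + Real.exp (-l) = 2 * Real.cosh l := by
    rw [Real.cosh_eq]
    ring
  calc expDiff l true false + expDiff l false true
      = ENNReal.ofReal (Real.exp l) + ENNReal.ofReal (Real.exp (-l)) := by simp [expDiff]
    _ = 2 * ENNReal.ofReal (Real.cosh l) := by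
        rw [← ENNReal.ofReal_add (Real.exp_pos _).le (Real.exp_pos _).le, hcosh,
          ENNReal.ofReal_mul zero_le_two, ENNReal.ofReal_ofNat]

theorem sum_expDiff_mul_le (l : ℝ) {Q : Bool → Bool → ℝ≥0∞} (hQ : ∀ a b, Q a b = Q b a) :
    ∑ a, ∑ b, expDiff l a b * Q a b ≤ ENNReal.ofReal (Real.cosh l) * ∑ a, ∑ b, Q a b := by
  set c := ENNReal.ofReal (Real.cosh l)
  have hc : 1 ≤ c := ENNReal.one_le_ofReal.2 (Real.one_le_cosh l)
  have hdiag (a : Bool) : expDiff l a a = 1 := by simp [expDiff]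
  calc ∑ a, ∑ b, expDiff l a b * Q a b
      = 1 * Q true true + (expDiff l true false + expDiff l false true) * Q true false +
          1 * Q false false := by
        simp only [Fintype.sum_bool, hdiag, hQ false true]
        ring
    _ ≤ c * Q true true + 2 * c * Q true false + c * Q false false := by
        rw [expDiff_true_false_add]
        gcongr
    _ = c * ∑ a, ∑ b, Q a b := by
        simp only [Fintype.sum_bool, hQ false true]
        ring

open Classical in
theorem supExpDeviation_succ_le (μ : Measure X) [IsProbabilityMeasure μ] (l : ℝ)
    {F : Set (Set X)} (hmeas : ∀ S ∈ F, MeasurableSet S) (T : ElementTree (n + 1) X) :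
    supExpDeviation μ l F T ≤ ∫⁻ y, ∑ a, ∑ b, expDiff l a b *
      supExpDeviation μ l (restrict (restrict F (root T) a) y b) (subtree T a) ∂μ := by
  refine iSup₂_le fun S hS => ?_
  set a := decide (root T ∈ S) with ha
  set D := ENNReal.ofReal (Real.exp (l * (hits (subtree T a) S - n * μ.real S))) with hD
  have hpoint (y : X) : ENNReal.ofReal (Real.exp (-l * S.indicator 1 y)) *
      ENNReal.ofReal (Real.exp (l * a.toNat)) = expDiff l a (decide (y ∈ S)) := by
    rw [← ENNReal.ofReal_mul (Real.exp_pos _).le, ← Real.exp_add, indicator_one_eq_toNat, expDiff]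
    ring_nf
  calc ENNReal.ofReal (Real.exp (l * (hits T S - (n + 1 : ℕ) * μ.real S)))
      = ENNReal.ofReal (Real.exp (-l * μ.real S)) *
          (ENNReal.ofReal (Real.exp (l * a.toNat)) * D) := by
        rw [hD, hits_succ, ← ha, ← ENNReal.ofReal_mul (Real.exp_pos _).le,
          ← ENNReal.ofReal_mul (Real.exp_pos _).le, ← Real.exp_add, ← Real.exp_add]
        push_cast
        ring_nf
    _ ≤ (∫⁻ y, ENNReal.ofReal (Real.exp (-l * S.indicator 1 y)) ∂μ) *
          (ENNReal.ofReal (Real.exp (l * a.toNat)) * D) := by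
        gcongr
        exact ofReal_exp_mul_measureReal_le μ (-l) (hmeas S hS)
    _ = ∫⁻ y, expDiff l a (decide (y ∈ S)) * D ∂μ := by
        rw [← lintegral_mul_const' _ _ (by finiteness)]
        simp only [← mul_assoc, hpoint]
    _ ≤ _ := by
        refine lintegral_mono fun y => ?_
        let f (a b : Bool) := expDiff l a b *
          supExpDeviation μ l (restrict (restrict F (root T) a) y b) (subtree T a)
        calc expDiff l a (decide (y ∈ S)) * D ≤ f a (decide (y ∈ S)) := by
              have hmem := mem_restrict_decide (mem_restrict_decide hS (root T)) y
              exact mul_le_mul_right (le_supExpDeviation μ l hmem _) _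
          _ ≤ ∑ b, f a b := Finset.single_le_sum_of_canonicallyOrdered (Finset.mem_univ _)
          _ ≤ ∑ a, ∑ b, f a b := Finset.single_le_sum_of_canonicallyOrdered
            (f := fun a => ∑ b, f a b) (Finset.mem_univ a)

theorem lintegral_supExpDeviation_succ_le (μ : Measure X) [IsProbabilityMeasure μ] (l : ℝ)
    {F : Set (Set X)} (hF : F.Countable) (hmeas : ∀ S ∈ F, MeasurableSet S) (n : ℕ) :
    ∫⁻ T, supExpDeviation μ l F T ∂treeMeasure μ (n + 1) ≤
      ∑ a, ∑ b, expDiff l a b *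
        ∫⁻ z, ∫⁻ T, supExpDeviation μ l (restrict (restrict F z.1 a) z.2 b) T
          ∂treeMeasure μ n ∂μ.prod μ :=
  (lintegral_mono (supExpDeviation_succ_le μ l hmeas)).trans_eq <|
    lintegral_lintegral_sum_root_subtree μ (expDiff l)
      (g := fun a b z T => supExpDeviation μ l (restrict (restrict F z.1 a) z.2 b) T)
      (measurable_supExpDeviation_restrict μ l hF hmeas)

theorem lintegral_supExpDeviation_le (μ : Measure X) [IsProbabilityMeasure μ] (l : ℝ)
    {F : Set (Set X)} (hF : F.Countable) (hmeas : ∀ S ∈ F, MeasurableSet S) (n : ℕ) :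
    ∫⁻ T, supExpDeviation μ l F T ∂treeMeasure μ n ≤
      ENNReal.ofReal (Real.cosh l) ^ n * thicketShatter F (2 * n) := by
  set c := ENNReal.ofReal (Real.cosh l)
  induction n generalizing F with
  | zero =>
    have hle (T : ElementTree 0 X) : supExpDeviation μ l F T ≤ thicketShatter F 0 :=
      iSup₂_le fun S hS => by simp [thicketShatter_zero ⟨S, hS⟩, hits]
    simpa using lintegral_mono (μ := treeMeasure μ 0) hle
  | succ n ih =>
    let q (a b : Bool) (z : X × X) : ℝ≥0∞ :=
      ∫⁻ T, supExpDeviation μ l (restrict (restrict F z.1 a) z.2 b) T ∂treeMeasure μ n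
    have hq (a b : Bool) : Measurable (q a b) :=
      (measurable_supExpDeviation_restrict μ l hF hmeas a b).lintegral_prod_right'
    have hswap (a b : Bool) : ∫⁻ z, q a b z ∂μ.prod μ = ∫⁻ z, q b a z ∂μ.prod μ := by
      rw [← lintegral_prod_swap]
      simp only [q, Prod.fst_swap, Prod.snd_swap, restrict_comm]
    have hsum (z : X × X) : ∑ a, ∑ b, q a b z ≤ c ^ n * thicketShatter F (2 * (n + 1)) := by
      have hcard : ∑ a, ∑ b, thicketShatter (restrict (restrict F z.1 a) z.2 b) (2 * n) ≤
          thicketShatter F (2 * (n + 1)) :=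
        (Finset.sum_le_sum fun a _ => sum_thicketShatter_restrict_le _ z.2 (2 * n)).trans
          (sum_thicketShatter_restrict_le F z.1 (2 * n + 1))
      have hsub (a b : Bool) : restrict (restrict F z.1 a) z.2 b ⊆ F :=
        (restrict_subset _ _ _).trans (restrict_subset _ _ _)
      calc ∑ a, ∑ b, q a b z
          ≤ ∑ a, ∑ b, c ^ n * (thicketShatter (restrict (restrict F z.1 a) z.2 b) (2 * n) : ℝ≥0∞) :=
            Finset.sum_le_sum fun a _ => Finset.sum_le_sum fun b _ =>
              ih (hF.mono (hsub a b)) fun S hS => hmeas S (hsub a b hS)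
        _ ≤ c ^ n * thicketShatter F (2 * (n + 1)) := by
            simp only [← Finset.mul_sum]
            gcongr
            exact_mod_cast hcard
    calc ∫⁻ T, supExpDeviation μ l F T ∂treeMeasure μ (n + 1)
        ≤ ∑ a, ∑ b, expDiff l a b * ∫⁻ z, q a b z ∂μ.prod μ :=
          lintegral_supExpDeviation_succ_le μ l hF hmeas n
      _ ≤ c * ∑ a, ∑ b, ∫⁻ z, q a b z ∂μ.prod μ := sum_expDiff_mul_le l hswap
      _ = c * ∫⁻ z, ∑ a, ∑ b, q a b z ∂μ.prod μ := by
          simpa using congrArg (c * ·) (lintegral_sum_sum_const_mul (μ.prod μ) 1 hq).symm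
      _ ≤ c * ∫⁻ _, c ^ n * thicketShatter F (2 * (n + 1)) ∂μ.prod μ := by
          gcongr with z
          exact hsum z
      _ = c ^ (n + 1) * thicketShatter F (2 * (n + 1)) := by
          rw [lintegral_const, measure_univ, mul_one, ← mul_assoc, ← pow_succ']

/-! ### The deviation inequality -/

theorem measure_exists_le_mul_deviation_le (μ : Measure X) [IsProbabilityMeasure μ] (l c : ℝ)
    {F : Set (Set X)} (hF : F.Countable) (hmeas : ∀ S ∈ F, MeasurableSet S) (n : ℕ) :
    treeMeasure μ n {T | ∃ S ∈ F, c ≤ l * (hits T S - n * μ.real S)} ≤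
      ENNReal.ofReal (Real.exp (-c)) *
        (ENNReal.ofReal (Real.cosh l) ^ n * thicketShatter F (2 * n)) := by
  have hsub : {T : ElementTree n X | ∃ S ∈ F, c ≤ l * (hits T S - n * μ.real S)} ⊆
      {T | ENNReal.ofReal (Real.exp c) ≤ supExpDeviation μ l F T} := fun T ⟨S, hS, hc⟩ =>
    (ENNReal.ofReal_le_ofReal (Real.exp_le_exp.2 hc)).trans (le_supExpDeviation μ l hS T)
  have hexp : ENNReal.ofReal (Real.exp (-c)) * ENNReal.ofReal (Real.exp c) = 1 := by
    rw [← ENNReal.ofReal_mul (Real.exp_pos _).le, ← Real.exp_add, neg_add_cancel, Real.exp_zero,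
      ENNReal.ofReal_one]
  calc treeMeasure μ n {T | ∃ S ∈ F, c ≤ l * (hits T S - n * μ.real S)}
      ≤ treeMeasure μ n {T | ENNReal.ofReal (Real.exp c) ≤ supExpDeviation μ l F T} :=
        measure_mono hsub
    _ = ENNReal.ofReal (Real.exp (-c)) * (ENNReal.ofReal (Real.exp c) *
          treeMeasure μ n {T | ENNReal.ofReal (Real.exp c) ≤ supExpDeviation μ l F T}) := by
        rw [← mul_assoc, hexp, one_mul]
    _ ≤ ENNReal.ofReal (Real.exp (-c)) * ∫⁻ T, supExpDeviation μ l F T ∂treeMeasure μ n := by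
        gcongr
        exact mul_meas_ge_le_lintegral (measurable_supExpDeviation μ l hF hmeas) _
    _ ≤ _ := by
        gcongr
        exact lintegral_supExpDeviation_le μ l hF hmeas n

theorem measureReal_exists_le_mul_deviation_le (μ : Measure X) [IsProbabilityMeasure μ] (l : ℝ)
    {F : Set (Set X)} (hF : F.Countable) (hmeas : ∀ S ∈ F, MeasurableSet S) (n : ℕ) :
    (treeMeasure μ n).real {T | ∃ S ∈ F, n * l ^ 2 ≤ l * (hits T S - n * μ.real S)} ≤
      thicketShatter F n ^ 2 * Real.exp (-(n * l ^ 2 / 2)) := by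
  have : Nonempty X := nonempty_of_isProbabilityMeasure μ
  have hcosh : Real.cosh l ^ n ≤ Real.exp (n * l ^ 2 / 2) := by
    rw [mul_div_assoc, Real.exp_nat_mul]
    gcongr
    exact Real.cosh_le_exp_half_sq l
  have hshatter : (thicketShatter F (2 * n) : ℝ) ≤ thicketShatter F n ^ 2 := by
    rw [two_mul, sq]
    exact_mod_cast thicketShatter_add_le F n n
  have hreal := ENNReal.toReal_mono (by finiteness)
    (measure_exists_le_mul_deviation_le μ l (n * l ^ 2) hF hmeas n)
  simp only [ENNReal.toReal_mul, ENNReal.toReal_pow, ENNReal.toReal_natCast,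
    ENNReal.toReal_ofReal (Real.exp_pos _).le, ENNReal.toReal_ofReal (Real.cosh_pos l).le] at hreal
  calc (treeMeasure μ n).real {T | ∃ S ∈ F, n * l ^ 2 ≤ l * (hits T S - n * μ.real S)}
      ≤ Real.exp (-(n * l ^ 2)) * (Real.cosh l ^ n * thicketShatter F (2 * n)) := hreal
    _ ≤ Real.exp (-(n * l ^ 2)) * (Real.exp (n * l ^ 2 / 2) * thicketShatter F n ^ 2) := by
        gcongr
    _ = thicketShatter F n ^ 2 * Real.exp (-(n * l ^ 2 / 2)) := by
        rw [← mul_assoc, ← Real.exp_add, mul_comm]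
        ring_nf

theorem measureReal_exists_lt_abs_test_sub_le (μ : Measure X) [IsProbabilityMeasure μ]
    {F : Set (Set X)} (hF : F.Countable) (hmeas : ∀ S ∈ F, MeasurableSet S) (n : ℕ) {ε : ℝ}
    (hε : 0 ≤ ε) :
    (treeMeasure μ n).real {T | ∃ S ∈ F, ε < |test T S - μ.real S|} ≤
      2 * (thicketShatter F n ^ 2 * Real.exp (-(n * ε ^ 2 / 2))) := by
  let A (l : ℝ) : Set (ElementTree n X) :=
    {T | ∃ S ∈ F, n * l ^ 2 ≤ l * (hits T S - n * μ.real S)}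
  have hhits (T : ElementTree n X) (S : Set X) :
      hits T S - n * μ.real S = n * (test T S - μ.real S) := by
    rw [mul_sub, mul_test]
  have hsub : {T | ∃ S ∈ F, ε < |test T S - μ.real S|} ⊆ A ε ∪ A (-ε) := by
    rintro T ⟨S, hS, hdev⟩
    refine (lt_abs.1 hdev).imp (fun h => ⟨S, hS, ?_⟩) fun h => ⟨S, hS, ?_⟩
    · calc n * ε ^ 2 = ε * (n * ε) := by ring
        _ ≤ ε * (hits T S - n * μ.real S) := by rw [hhits]; gcongr
    · calc n * (-ε) ^ 2 = ε * (n * ε) := by ring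
        _ ≤ ε * (n * -(test T S - μ.real S)) := by gcongr
        _ = -ε * (hits T S - n * μ.real S) := by rw [hhits]; ring
  calc (treeMeasure μ n).real {T | ∃ S ∈ F, ε < |test T S - μ.real S|}
      ≤ (treeMeasure μ n).real (A ε) + (treeMeasure μ n).real (A (-ε)) :=
        (measureReal_mono hsub).trans (measureReal_union_le _ _)
    _ ≤ thicketShatter F n ^ 2 * Real.exp (-(n * ε ^ 2 / 2)) +
          thicketShatter F n ^ 2 * Real.exp (-(n * (-ε) ^ 2 / 2)) :=
        add_le_add (measureReal_exists_le_mul_deviation_le μ ε hF hmeas n)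
          (measureReal_exists_le_mul_deviation_le μ (-ε) hF hmeas n)
    _ = 2 * (thicketShatter F n ^ 2 * Real.exp (-(n * ε ^ 2 / 2))) := by
        rw [neg_sq, two_mul]

end Thicket

end

theorem mainTheorem5_general {X : Type*} [MeasurableSpace X] (μ : Measure X)
    [IsProbabilityMeasure μ] {F : Set (Set X)} (hF : F.Countable)
    (hmeas : ∀ S ∈ F, MeasurableSet S) (n : ℕ) {ε : ℝ} (hε : 0 ≤ ε) :
    (Measure.pi fun _ : Thicket.Node n => μ).real
        {x : Thicket.ElementTree n X | ε < ⨆ S : F, |Thicket.test x S - μ.real S|} ≤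
      8 * (Thicket.thicketShatter F n : ℝ) * Real.exp (-((n : ℝ) * ε ^ 2 / 32)) := by
  set ρ : ℝ := (Thicket.thicketShatter F n : ℝ)
  set E : ℝ := Real.exp (-(n * ε ^ 2 / 32))
  have hsub : {x : Thicket.ElementTree n X | ε < ⨆ S : F, |Thicket.test x S - μ.real S|} ⊆
      {x | ∃ S ∈ F, ε < |Thicket.test x S - μ.real S|} := by
    intro x hx
    by_contra hnot
    simp only [Set.mem_ofPred_eq, not_exists, not_and, not_lt] at hnot
    exact (Real.iSup_le (fun S : F => hnot S S.2) hε).not_gt hx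
  have hexp : Real.exp (-(n * ε ^ 2 / 2)) ≤ E ^ 2 := by
    rw [← Real.exp_nat_mul, Real.exp_le_exp]
    nlinarith [mul_nonneg (Nat.cast_nonneg (α := ℝ) n) (sq_nonneg ε)]
  rcases le_total 1 (8 * ρ * E) with hlarge | hsmall
  · exact measureReal_le_one.trans hlarge
  calc (Measure.pi fun _ : Thicket.Node n => μ).real
        {x : Thicket.ElementTree n X | ε < ⨆ S : F, |Thicket.test x S - μ.real S|}
      ≤ 2 * (ρ ^ 2 * Real.exp (-(n * ε ^ 2 / 2))) :=
        (measureReal_mono hsub).trans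
          (Thicket.measureReal_exists_lt_abs_test_sub_le μ hF hmeas n hε)
    _ ≤ 2 * (ρ ^ 2 * E ^ 2) := by gcongr
    _ ≤ 8 * ρ * E := by nlinarith [show 0 ≤ ρ * E by positivity]

theorem mainTheorem5 {X : Type*} [Finite X] [MeasurableSpace X] [DiscreteMeasurableSpace X]
    (μ : Measure X) [IsProbabilityMeasure μ] (F : Set (Set X)) (n : ℕ) (ε : ℝ) (hε : 0 < ε) :
    (Measure.pi fun _ : Thicket.Node n => μ).real
        {x : Thicket.ElementTree n X | ε < ⨆ S : F, |Thicket.test x (S : Set X) - μ.real (S : Set X)|}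
      ≤ 8 * (Thicket.thicketShatter F n : ℝ) * Real.exp (-((n : ℝ) * ε ^ 2 / 32)) :=
  mainTheorem5_general μ F.toFinite.countable (fun _ _ => .of_discrete) n hε.le
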